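/- Let $\Omega\subseteq\mathbb R^3$ be a bounded open set, $\mathcal C=\overline\Omega\times[0,\infty)$ and $\mathcal C_t=\overline\Omega\times[0,t]$. A Radon measure on $\mathcal C$ is a $\sigma$-finite Borel measure that is finite on compact sets; it is a counting measure if its values on Borel sets lie in $\{0,1,2,\dots\}\cup\{\infty\}$. Let $\mathcal R_c$ be the set of Radon counting measures on $\mathcal C$, with the $\sigma$-algebra generated by the maps $\gamma\mapsto\int_{\mathcal C} f\,d\gamma$, where $f:\mathcal C\to\mathbb R$ is continuous with compact support. A measure $\gamma\in\mathcal R_c$ is simple if for every $t\ge 0$ its restriction to $\mathcal C_t$ is a finite sum of unit Dirac measures at distinct points. Its failure time is $\tau(\gamma)=\inf\{t\ge 0:\gamma(\mathcal C_t)>0\}\in[0,\infty]$, with $\inf\emptyset=\infty$. Let $(\mathscr X,\mathscr A,P)$ be a probability space and let $\gamma:\mathscr X\to\mathcal R_c$ be a crack initiation process, that is, a measurable map (point process) such that $\gamma$ is simple $P$-almost surely and $P(\gamma(\{c\})>0)=0$ for every $c\in\mathcal C$. Suppose that $\gamma$ has independent increments: for all mutually disjoint Borel sets $C_1,\dots,C_n\subseteq\mathcal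 C$, the random variables $\gamma(C_1),\dots,\gamma(C_n)$ are independent. Then $\gamma$ is a Poisson point process: there is exactly one Radon measure $\rho$ on $\mathcal C$, called the intensity measure of $\gamma$, such that $$P(\gamma(C)=n)=e^{-\rho(C)}\,\frac{\rho(C)^n}{n!}$$ for all Borel sets $C\subseteq\mathcal C$ and all $n\in\{0,1,2,\dots\}$, where the right-hand side is read as $0$ if $\rho(C)=\infty$. This $\rho$ satisfies $\rho(\{c\})=0$ for all $c\in\mathcal C$ and $\rho(\mathcal C_t)<\infty$ for all $t\ge 0$. The first failure time $\tau=\tau(\gamma)$ is a random variable, and the following holds. (i) The cumulative distribution function of $\tau$ is $F_\tau(t)=P(\tau\le t)=1-e^{-\rho(\mathcal C_t)}$ for $t\ge 0$. (ii) Let $H(t)=\rho(\mathcal C_t)$ for $t\ge 0$. If $H$ is differentiable at $t\ge 0$ (from the right if $t=0$), then $H'(t)$ is the hazard rate of $\tau$ at $t$, that is, $P(\tau>t)>0$ and $$H'(t)=\lim_{\Delta\searrow 0}\frac1\Delta\,P\big(\tau\in[t,t+\Delta]\,\big|\,\tau>t\big).$$ -/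

import Mathlib

open MeasureTheory ProbabilityTheory Set Filter Topology
open scoped NNReal ENNReal Nat CompactlySupported

noncomputable section

namespace CrackInitiation

/-- A Radon measure: a σ-finite measure that is finite on compact sets. -/
structure IsRadon {α : Type*} [TopologicalSpace α] [MeasurableSpace α] (μ : Measure α) : Prop where
  sigmaFinite : SigmaFinite μ
  finiteOnCompacts : ∀ K : Set α, IsCompact K → μ K < ∞

/-- The Radon counting measures on `α`: the Radon measures whose values on measurable sets lie in
`{0, 1, 2, …} ∪ {∞}`. -/
structure RadonCountingMeasure (α : Type*) [TopologicalSpace α] [MeasurableSpace α] where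
  toMeasure : Measure α
  isRadon : IsRadon toMeasure
  isCounting : ∀ C : Set α, MeasurableSet C → ∃ n : ℕ∞, toMeasure C = (n : ℝ≥0∞)

/-- The σ-algebra on the Radon counting measures that is generated by the maps `γ ↦ ∫ f dγ`, for
`f` real-valued, continuous and compactly supported. -/
instance RadonCountingMeasure.instMeasurableSpace (α : Type*) [TopologicalSpace α]
    [MeasurableSpace α] : MeasurableSpace (RadonCountingMeasure α) :=
  ⨆ f : C_c(α, ℝ), (borel ℝ).comap (fun γ : RadonCountingMeasure α => ∫ c, f c ∂γ.toMeasure)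

/-- The configuration space `closure Ω × [0, ∞)`, whose points are pairs of a location in the
component and a time. -/
abbrev Config (Ω : Set (EuclideanSpace ℝ (Fin 3))) : Type := ↥(closure Ω) × ℝ≥0

section

variable {Ω : Set (EuclideanSpace ℝ (Fin 3))}

/-- The configurations `closure Ω × [0, t]` up to time `t`. -/
def upTo (Ω : Set (EuclideanSpace ℝ (Fin 3))) (t : ℝ) : Set (Config Ω) := {c | (c.2 : ℝ) ≤ t}

/-- A Radon counting measure is simple if, for every `t`, its restriction to the configurations up
to time `t` is a finite sum of unit Dirac measures in distinct points. -/
def IsSimple (γ : RadonCountingMeasure (Config Ω)) : Prop :=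
  ∀ t : ℝ≥0, ∃ S : Finset (Config Ω),
    γ.toMeasure.restrict (upTo Ω t) = ∑ c ∈ S, Measure.dirac c

/-- The failure time `inf {t ≥ 0 : γ (closure Ω × [0, t]) > 0}`, an element of `[0, ∞]`, equal to
`∞` if there is no such `t`. -/
def failureTime (γ : RadonCountingMeasure (Config Ω)) : ℝ≥0∞ :=
  sInf ((fun t : ℝ≥0 => (t : ℝ≥0∞)) '' {t : ℝ≥0 | 0 < γ.toMeasure (upTo Ω t)})

variable {X : Type*} [MeasurableSpace X]

/-- A crack initiation process: a simple, non-atomic point process on `closure Ω × [0, ∞)`. -/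
structure IsCrackInitiationProcess (P : Measure X) (γ : X → RadonCountingMeasure (Config Ω)) :
    Prop where
  measurable : Measurable γ
  simple : ∀ᵐ ω ∂P, IsSimple (γ ω)
  nonAtomic : ∀ c : Config Ω, P {ω | 0 < (γ ω).toMeasure {c}} = 0

/-- Independent increments: the numbers of points in finitely many mutually disjoint measurable
sets are independent random variables. -/
def HasIndependentIncrements (P : Measure X) (γ : X → RadonCountingMeasure (Config Ω)) : Prop :=
  ∀ (n : ℕ) (C : Fin n → Set (Config Ω)), (∀ i, MeasurableSet (C i)) →
    Pairwise (Function.onFun Disjoint C) →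
    iIndepFun (fun i ω => (γ ω).toMeasure (C i)) P

/-- `γ` is a Poisson point process with intensity measure `ρ`. The numbers `ρ C` lie in `[0, ∞]`;
here `exp (-∞) = 0` and `0 * ∞ = 0`, so that `γ C = ∞` almost surely if `ρ C = ∞`. -/
structure IsPoissonPointProcess (P : Measure X) (γ : X → RadonCountingMeasure (Config Ω))
    (ρ : Measure (Config Ω)) : Prop where
  measurable : Measurable γ
  isRadon : IsRadon ρ
  poisson : ∀ C : Set (Config Ω), MeasurableSet C → ∀ n : ℕ,
    P {ω | (γ ω).toMeasure C = (n : ℝ≥0∞)} =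
      EReal.exp (-(ρ C : EReal)) * ρ C ^ n / ((n ! : ℕ) : ℝ≥0∞)
  indep : HasIndependentIncrements P γ

/-- The cumulative distribution function `t ↦ P (τ ≤ t)` of a random time `τ` in `[0, ∞]`. -/
def distributionFunction (P : Measure X) (τ : X → ℝ≥0∞) (t : ℝ≥0) : ℝ :=
  P.real {ω | τ ω ≤ t}

/-- `h` is the hazard rate at time `t` of the random time `τ`: the event `τ > t` has positive
probability and `h = lim_{Δ ↘ 0} P (τ ∈ [t, t + Δ] | τ > t) / Δ`. -/
def HasHazardRateAt (P : Measure X) (τ : X → ℝ≥0∞) (h : ℝ) (t : ℝ≥0) : Prop :=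
  0 < P {ω | (t : ℝ≥0∞) < τ ω} ∧
  Tendsto
    (fun Δ : ℝ => 1 / Δ *
      (ProbabilityTheory.cond P {ω | (t : ℝ≥0∞) < τ ω}).real
        {ω | τ ω ∈ Icc (t : ℝ≥0∞) (t + ENNReal.ofReal Δ)})
    (𝓝[>] 0) (𝓝 h)

end

end CrackInitiation

end

/-! The intensity is `ρ C = E γ(C)`, and the Poisson law comes from the law of rare events. Let `B`
be a Borel subset of the compact set `upTo Ω t`. Since no point carries an atom with positive
probability, compactness yields partitions into finitely many small pieces, each hit with small
probability (`exists_fin_partition`). The counts of `B` in the pieces are independent and add up to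
`γ(B)`. By simplicity, almost surely every count is at most one once the pieces are finer than the
gaps between atoms. So `γ(B)` is Poisson with mean `ρ B` (`map_eq_poissonMeasure_of_nullArray`);
finiteness of this mean is part of the conclusion, deduced from `P(γ(B) = 0) > 0`. Exhausting by
bounded times extends the law to all Borel sets (`measure_eq_poissonProbability`).

Void probabilities `exp(-ρ C)` determine `ρ`. As `γ` is integer-valued and finite on compact sets,
`τ ≤ t` exactly when `γ` charges `upTo Ω t` (`failureTime_le_iff`), so the distribution function of
`τ` is also a void probability, and the hazard rate is found by differentiating it. -/

namespace CrackInitiation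

/-! ### Poisson limit of generating functions -/

/-- Telescoping: factors are exchanged one at a time, and the remaining ones have norm at most one.
-/
theorem norm_prod_sub_prod_le {ι : Type*} (s : Finset ι) (a b : ι → ℂ)
    (ha : ∀ i ∈ s, ‖a i‖ ≤ 1) (hb : ∀ i ∈ s, ‖b i‖ ≤ 1) :
    ‖∏ i ∈ s, a i - ∏ i ∈ s, b i‖ ≤ ∑ i ∈ s, ‖a i - b i‖ := by
  classical
  induction s using Finset.induction_on with
  | empty => simp
  | insert j s hj ih =>
    rw [Finset.prod_insert hj, Finset.prod_insert hj, Finset.sum_insert hj]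
    have ih' := ih (fun i hi => ha i (Finset.mem_insert_of_mem hi))
      (fun i hi => hb i (Finset.mem_insert_of_mem hi))
    have hA : ‖∏ i ∈ s, a i‖ ≤ 1 := by
      rw [norm_prod]
      exact Finset.prod_le_one (fun _ _ => norm_nonneg _)
        (fun i hi => ha i (Finset.mem_insert_of_mem hi))
    have hbj := hb j (Finset.mem_insert_self j s)
    calc ‖a j * ∏ i ∈ s, a i - b j * ∏ i ∈ s, b i‖
        = ‖(a j - b j) * ∏ i ∈ s, a i + b j * (∏ i ∈ s, a i - ∏ i ∈ s, b i)‖ := by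
          congr 1; ring
      _ ≤ ‖a j - b j‖ * ‖∏ i ∈ s, a i‖ + ‖b j‖ * ‖∏ i ∈ s, a i - ∏ i ∈ s, b i‖ := by
          rw [← norm_mul, ← norm_mul]; exact norm_add_le _ _
      _ ≤ ‖a j - b j‖ * 1 + 1 * ‖∏ i ∈ s, a i - ∏ i ∈ s, b i‖ := by gcongr
      _ ≤ _ := by linarith

theorem norm_one_add_mul_sub_one_le {w : ℂ} (hw : ‖w‖ ≤ 1) {p : ℝ} (h0 : 0 ≤ p) (h1 : p ≤ 1) :
    ‖1 + (p : ℂ) * (w - 1)‖ ≤ 1 := by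
  calc ‖1 + (p : ℂ) * (w - 1)‖ = ‖((1 - p : ℝ) : ℂ) + (p : ℂ) * w‖ := by
        congr 1; push_cast; ring
    _ ≤ ‖((1 - p : ℝ) : ℂ)‖ + ‖(p : ℂ)‖ * ‖w‖ := by
        rw [← norm_mul]; exact norm_add_le _ _
    _ ≤ (1 - p) + p * 1 := by
        rw [Complex.norm_of_nonneg (by linarith), Complex.norm_of_nonneg h0]; gcongr
    _ = 1 := by ring

theorem norm_exp_mul_sub_one_le {w : ℂ} (hw : ‖w‖ ≤ 1) {p : ℝ} (h0 : 0 ≤ p) :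
    ‖Complex.exp ((p : ℂ) * (w - 1))‖ ≤ 1 := by
  rw [Complex.norm_exp, Real.exp_le_one_iff]
  have : w.re ≤ 1 := (Complex.re_le_norm w).trans hw
  simp only [Complex.mul_re, Complex.ofReal_re, Complex.sub_re, Complex.one_re, Complex.ofReal_im,
    zero_mul, sub_zero]
  exact mul_nonpos_of_nonneg_of_nonpos h0 (by linarith)

/-- The generating functions of the numbers of successes in null arrays of trials converge to that
of the Poisson distribution. -/
theorem tendsto_prod_one_add_mul_sub_one {k : ℕ → ℕ} {p : ∀ m, Fin (k m) → ℝ} {ε : ℕ → ℝ} {r : ℝ}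
    (hp : ∀ m i, 0 ≤ p m i) (hpε : ∀ m i, p m i ≤ ε m) (hε : Tendsto ε atTop (𝓝 0))
    (hsum : Tendsto (fun m => ∑ i, p m i) atTop (𝓝 r)) {w : ℂ} (hw : ‖w‖ ≤ 1) :
    Tendsto (fun m => ∏ i, (1 + (p m i : ℂ) * (w - 1))) atTop
      (𝓝 (Complex.exp ((r : ℂ) * (w - 1)))) := by
  have hlim : Tendsto (fun m => Complex.exp (((∑ i, p m i : ℝ) : ℂ) * (w - 1))) atTop
      (𝓝 (Complex.exp ((r : ℂ) * (w - 1)))) :=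
    (Complex.continuous_exp.tendsto _).comp
      (((Complex.continuous_ofReal.tendsto _).comp hsum).mul_const _)
  have hdiff : Tendsto (fun m => ∏ i, (1 + (p m i : ℂ) * (w - 1)) -
      Complex.exp (((∑ i, p m i : ℝ) : ℂ) * (w - 1))) atTop (𝓝 0) := by
    -- With `z = p (w - 1)`, corresponding factors differ by `|exp z - 1 - z| ≤ |z|²`, and `|z| ≤
    -- 2p` gives `4p² ≤ 4εp`. The bound needs `|z| ≤ 1`, hence `ε < 1/2`.
    refine squeeze_zero_norm' (a := fun m => 4 * (ε m * ∑ i, p m i)) ?_ ?_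
    · filter_upwards [hε.eventually (Iio_mem_nhds (show (0 : ℝ) < 1 / 2 by norm_num))] with m hm
      have hw2 : ‖w - 1‖ ≤ 2 := (norm_sub_le _ _).trans (by simpa using by linarith)
      have hm' : ε m < 1 / 2 := hm
      rw [Complex.ofReal_sum, Finset.sum_mul, Complex.exp_sum]
      refine (norm_prod_sub_prod_le _ _ _
        (fun i _ => norm_one_add_mul_sub_one_le hw (hp m i) (by linarith [hpε m i]))
        (fun i _ => norm_exp_mul_sub_one_le hw (hp m i))).trans ?_
      rw [Finset.mul_sum, Finset.mul_sum]
      refine Finset.sum_le_sum fun i _ => ?_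
      have hn : ‖(p m i : ℂ) * (w - 1)‖ ≤ 2 * p m i := by
        rw [norm_mul, Complex.norm_of_nonneg (hp m i)]
        nlinarith [hp m i]
      rw [norm_sub_rev, ← sub_sub]
      calc _ ≤ ‖(p m i : ℂ) * (w - 1)‖ ^ 2 :=
            Complex.norm_exp_sub_one_sub_id_le (by linarith [hpε m i])
        _ ≤ (2 * p m i) ^ 2 := by gcongr
        _ ≤ 4 * (ε m * p m i) := by nlinarith [hp m i, hpε m i]
    · simpa using (hε.mul hsum).const_mul 4
  simpa using hdiff.add hlim

/-! ### Law of rare events -/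

section RareEvents

variable {X : Type*} [MeasurableSpace X] {P : Measure X} [IsProbabilityMeasure P]

theorem integral_ite_eq_zero {ξ : X → ℕ} (hξ : Measurable ξ) (w : ℂ) :
    ∫ ω, (if ξ ω = 0 then 1 else w) ∂P = 1 + (P.real {ω | ξ ω ≠ 0} : ℂ) * (w - 1) := by
  have hA : MeasurableSet {ω | ξ ω ≠ 0} := hξ (MeasurableSet.of_discrete (s := {n | n ≠ 0}))
  have : ∀ ω, (if ξ ω = 0 then 1 else w) =
      1 + {ω | ξ ω ≠ 0}.indicator (fun _ => w - 1) ω := by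
    intro ω
    by_cases h : ξ ω = 0 <;> simp [h]
  simp_rw [this]
  rw [integral_add (integrable_const _) ((integrable_const _).indicator hA),
    integral_indicator_const _ hA]
  simp

/-- **Law of rare events**: if `N` is, for every `m`, the sum of the `m`-th row of a null array of
row-wise independent variables, whose entries are eventually at most one, then `N` has a Poisson
distribution. -/
theorem map_eq_poissonMeasure_of_nullArray {N : X → ℕ} (hN : Measurable N) {k : ℕ → ℕ}
    {ξ : ∀ m, Fin (k m) → X → ℕ} (hξ : ∀ m i, Measurable (ξ m i))
    (hind : ∀ m, iIndepFun (ξ m) P) (hsum : ∀ m ω, N ω = ∑ i, ξ m i ω)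
    (hle : ∀ᵐ ω ∂P, ∀ᶠ m in atTop, ∀ i, ξ m i ω ≤ 1) {ε : ℕ → ℝ}
    (hε : Tendsto ε atTop (𝓝 0)) (hpε : ∀ m i, P.real {ω | ξ m i ω ≠ 0} ≤ ε m) :
    ∫⁻ ω, (N ω : ℝ≥0∞) ∂P ≠ ∞ ∧
      P.map N = poissonMeasure (∫⁻ ω, (N ω : ℝ≥0∞) ∂P).toNNReal := by
  -- The number of nonzero entries in row `m`: a sum of independent Bernoulli variables, at most
  -- `N`, and almost surely equal to `N` for large `m`.
  set K : ℕ → X → ℕ := fun m ω => ∑ i, if ξ m i ω = 0 then 0 else 1 with hK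
  have hmeas : ∀ m i, MeasurableSet {ω | ξ m i ω ≠ 0} := fun m i =>
    hξ m i (MeasurableSet.of_discrete (s := {n | n ≠ 0}))
  have hmeas0 : ∀ m i, MeasurableSet {ω | ξ m i ω = 0} := fun m i =>
    hξ m i (MeasurableSet.of_discrete (s := {n | n = 0}))
  have hKmeas : ∀ m, Measurable (K m) := fun m =>
    Finset.measurable_fun_sum _ fun i _ => Measurable.ite (hmeas0 m i) measurable_const
      measurable_const
  have hKle : ∀ m ω, K m ω ≤ N ω := fun m ω => by
    rw [hsum m ω]
    refine Finset.sum_le_sum fun i _ => ?_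
    split_ifs <;> omega
  have hKeq : ∀ᵐ ω ∂P, ∀ᶠ m in atTop, K m ω = N ω := by
    filter_upwards [hle] with ω hω
    filter_upwards [hω] with m hm
    rw [hsum m ω]
    refine Finset.sum_congr rfl fun i _ => ?_
    have := hm i
    split_ifs <;> omega
  set Λ := ∫⁻ ω, (N ω : ℝ≥0∞) ∂P with hΛ
  have hS : ∀ m, ∫⁻ ω, (K m ω : ℝ≥0∞) ∂P = ∑ i, P {ω | ξ m i ω ≠ 0} := fun m => by
    have : ∀ ω, (K m ω : ℝ≥0∞) = ∑ i, {ω | ξ m i ω ≠ 0}.indicator 1 ω := fun ω => by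
      simp only [hK, Nat.cast_sum]
      refine Finset.sum_congr rfl fun i _ => ?_
      by_cases h : ξ m i ω = 0 <;> simp [h]
    simp_rw [this]
    rw [lintegral_finsetSum _ fun i _ => measurable_one.indicator (hmeas m i)]
    simp_rw [lintegral_indicator_one (hmeas m _)]
  have hSle : ∀ m, ∑ i, P {ω | ξ m i ω ≠ 0} ≤ Λ := fun m => by
    rw [← hS m]
    exact lintegral_mono fun ω => Nat.cast_le.2 (hKle m ω)
  -- Fatou bounds the limit from below and `K ≤ N` from above, so `Λ = ∞` is still allowed here.
  have hSlim : Tendsto (fun m => ∑ i, P {ω | ξ m i ω ≠ 0}) atTop (𝓝 Λ) := by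
    refine tendsto_of_le_liminf_of_limsup_le ?_ (limsup_le_of_le (by isBoundedDefault)
      (Eventually.of_forall hSle))
    simp_rw [← hS]
    refine le_trans (lintegral_mono_ae ?_)
      (lintegral_liminf_le fun m => Measurable.comp measurable_from_top (hKmeas m))
    filter_upwards [hKeq] with ω hω
    have : Tendsto (fun m => (K m ω : ℝ≥0∞)) atTop (𝓝 (N ω : ℝ≥0∞)) :=
      tendsto_const_nhds.congr' (hω.mono fun m hm => by simp only [hm])
    exact this.liminf_eq.ge
  have hprod : ∀ m, P.real {ω | N ω = 0} = ∏ i, (1 - P.real {ω | ξ m i ω ≠ 0}) := fun m => by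
    have h1 : {ω | N ω = 0} = ⋂ i ∈ (Finset.univ : Finset (Fin (k m))), ξ m i ⁻¹' {0} := by
      ext ω
      simp [hsum m ω]
    rw [measureReal_def, h1, (hind m).measure_inter_preimage_eq_mul Finset.univ
      (sets := fun _ => {0}) (fun i _ => MeasurableSet.of_discrete), ENNReal.toReal_prod]
    refine Finset.prod_congr rfl fun i _ => ?_
    have h2 : {ω | ξ m i ω ≠ 0}ᶜ = ξ m i ⁻¹' {0} := by ext ω; simp
    rw [← measureReal_def, ← h2, probReal_compl_eq_one_sub (hmeas m i)]
  -- A single row with all success probabilities below one suffices. Then `1 - p ≤ exp(-p)` bounds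
  -- every row sum by `-log P(N = 0)`, which forces `Λ` to be finite.
  have hpos : 0 < P.real {ω | N ω = 0} := by
    obtain ⟨m, hm⟩ := (hε.eventually (Iio_mem_nhds (show (0 : ℝ) < 1 by norm_num))).exists
    rw [hprod m]
    exact Finset.prod_pos fun i _ => by linarith [hpε m i, show ε m < 1 from hm]
  have hSreal : ∀ m, ∑ i, P.real {ω | ξ m i ω ≠ 0} ≤ -Real.log (P.real {ω | N ω = 0}) := fun m => by
    rw [le_neg, Real.log_le_iff_le_exp hpos, hprod m, ← Finset.sum_neg_distrib, Real.exp_sum]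
    refine Finset.prod_le_prod (fun i _ => sub_nonneg.2 measureReal_le_one) fun i _ => ?_
    linarith [Real.add_one_le_exp (-P.real {ω | ξ m i ω ≠ 0})]
  have hΛtop : Λ ≠ ∞ := by
    refine ne_top_of_le_ne_top ENNReal.ofReal_ne_top (le_of_tendsto hSlim
      (Eventually.of_forall fun m => ?_) : Λ ≤ ENNReal.ofReal (-Real.log (P.real {ω | N ω = 0})))
    rw [← ENNReal.ofReal_toReal (a := ∑ i, P {ω | ξ m i ω ≠ 0})
      (ENNReal.sum_ne_top.2 fun i _ => measure_ne_top _ _)]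
    refine ENNReal.ofReal_le_ofReal ?_
    rw [ENNReal.toReal_sum fun i _ => measure_ne_top _ _]
    exact hSreal m
  refine ⟨hΛtop, ?_⟩
  have hSlim' : Tendsto (fun m => ∑ i, P.real {ω | ξ m i ω ≠ 0}) atTop (𝓝 Λ.toReal) := by
    refine ((ENNReal.tendsto_toReal hΛtop).comp hSlim).congr fun m => ?_
    exact ENNReal.toReal_sum fun i _ => measure_ne_top _ _
  apply (MeasurableEmbedding.natCast (α := ℝ)).map_injective
  have := Measure.isProbabilityMeasure_map (μ := P) hN.aemeasurable
  have : IsProbabilityMeasure ((P.map N).map (Nat.cast : ℕ → ℝ)) :=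
    Measure.isProbabilityMeasure_map .of_discrete
  apply Measure.ext_of_charFun
  ext t
  rw [charFun_map_cast_poissonMeasure, charFun_apply, integral_map .of_discrete (by fun_prop),
    integral_map hN.aemeasurable .of_discrete]
  set w : ℂ := Complex.exp (t * Complex.I) with hwdef
  have hw : ‖w‖ = 1 := Complex.norm_exp_ofReal_mul_I t
  have hpow : ∀ n : ℕ, Complex.exp ((inner ℝ (n : ℝ) t : ℝ) * Complex.I) = w ^ n := fun n => by
    rw [hwdef, ← Complex.exp_nat_mul]
    congr 1
    simp [mul_comm]
    ring
  simp_rw [hpow]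
  -- The sequence `E[w ^ K m]` has two limits: the characteristic function of `N` by dominated
  -- convergence, and the Poisson one by independence.
  have hlim1 : Tendsto (fun m => ∫ ω, w ^ K m ω ∂P) atTop (𝓝 (∫ ω, w ^ N ω ∂P)) := by
    refine tendsto_integral_of_dominated_convergence (fun _ => 1)
      (fun m => ((measurable_from_top (f := fun n : ℕ => w ^ n)).comp
        (hKmeas m)).aestronglyMeasurable) (integrable_const _)
      (fun m => ae_of_all _ fun ω => by simp [hw]) ?_
    filter_upwards [hKeq] with ω hω
    exact tendsto_const_nhds.congr' (hω.mono fun m hm => by simp only [hm])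
  have hlim2 : Tendsto (fun m => ∫ ω, w ^ K m ω ∂P) atTop
      (𝓝 (Complex.exp ((Λ.toReal : ℂ) * (w - 1)))) := by
    refine (tendsto_prod_one_add_mul_sub_one (fun m i => measureReal_nonneg) hpε hε hSlim'
      hw.le).congr fun m => ?_
    have h1 : ∀ ω, w ^ K m ω = ∏ i, (fun n : ℕ => if n = 0 then 1 else w) (ξ m i ω) := fun ω => by
      simp only [hK, ← Finset.prod_pow_eq_pow_sum]
      refine Finset.prod_congr rfl fun i _ => ?_
      split_ifs <;> simp
    simp_rw [h1]
    rw [(hind m).integral_fun_prod_comp (f := fun _ n => if n = 0 then 1 else w)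
      (fun i => (hξ m i).aemeasurable) (fun i => .of_discrete)]
    exact Finset.prod_congr rfl fun i _ => (integral_ite_eq_zero (hξ m i) w).symm
  exact tendsto_nhds_unique hlim1 hlim2

end RareEvents

/-! ### Measurability of the evaluations on Borel sets -/

section Measurability

namespace RadonCountingMeasure

variable {α : Type*} [MetricSpace α] [ProperSpace α] [MeasurableSpace α] [BorelSpace α]

/-- The indicator of `K` is the pointwise limit of continuous thickened indicators, all supported in
one compact thickening, so dominated convergence applies. -/
theorem measurable_measure_of_isCompact {K : Set α} (hK : IsCompact K) :
    Measurable fun γ : RadonCountingMeasure α => γ.toMeasure K := by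
  have hδ : ∀ n : ℕ, 0 < (1 : ℝ) / (n + 1) := fun n => Nat.one_div_pos_of_nat
  have hK1 : IsCompact (Metric.cthickening 1 K) := hK.cthickening
  have hzero : ∀ n : ℕ, ∀ x ∉ Metric.cthickening 1 K, thickenedIndicator (hδ n) K x = 0 := by
    intro n x hx
    refine thickenedIndicator_zero _ _ fun h => hx (Metric.thickening_subset_cthickening _ _ ?_)
    refine Metric.thickening_mono ?_ K h
    rw [div_le_one (by positivity)]
    linarith [n.cast_nonneg (α := ℝ)]
  let F : ℕ → C_c(α, ℝ) := fun n =>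
    { toFun := fun x => (thickenedIndicator (hδ n) K x : ℝ)
      continuous_toFun := by fun_prop
      hasCompactSupport' := HasCompactSupport.intro hK1 fun x hx => by rw [hzero n x hx, NNReal.coe_zero] }
  have hF : ∀ n, Measurable fun γ : RadonCountingMeasure α => ∫ c, F n c ∂γ.toMeasure := by
    intro n
    rw [measurable_iff_comap_le, BorelSpace.measurable_eq (α := ℝ)]
    exact le_iSup (fun f : C_c(α, ℝ) =>
      (borel ℝ).comap fun γ : RadonCountingMeasure α => ∫ c, f c ∂γ.toMeasure) (F n)
  have hlim : Measurable fun γ : RadonCountingMeasure α => γ.toMeasure.real K := by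
    refine measurable_of_tendsto_metrizable hF (tendsto_pi_nhds.2 fun γ => ?_)
    rw [← integral_indicator_one hK.measurableSet]
    refine tendsto_integral_of_dominated_convergence
      ((Metric.cthickening 1 K).indicator fun _ => 1)
      (fun n => (F n).continuous.aestronglyMeasurable) ?_ (fun n => ae_of_all _ fun x => ?_)
      (ae_of_all _ fun x => ?_)
    · exact (integrableOn_const (hs := (γ.isRadon.finiteOnCompacts _ hK1).ne)).integrable_indicator
        hK1.measurableSet
    · change ‖(thickenedIndicator (hδ n) K x : ℝ)‖ ≤ _
      by_cases hx : x ∈ Metric.cthickening 1 K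
      · simpa [hx] using thickenedIndicator_le_one (hδ n) K x
      · simp only [hzero n x hx, NNReal.coe_zero, norm_zero, indicator_of_notMem hx, le_refl]
    · have h := tendsto_pi_nhds.1 (thickenedIndicator_tendsto_indicator_closure hδ
        tendsto_one_div_add_atTop_nhds_zero_nat K) x
      rw [hK.isClosed.closure_eq] at h
      have h' := (NNReal.continuous_coe.tendsto _).comp h
      have hx : K.indicator (1 : α → ℝ) x = ((K.indicator (fun _ => (1 : ℝ≥0)) x : ℝ≥0) : ℝ) := by
        by_cases hx : x ∈ K <;> simp [hx]
      rw [hx]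
      exact h'
  convert hlim.ennreal_ofReal using 2 with γ
  exact (ENNReal.ofReal_toReal (γ.isRadon.finiteOnCompacts _ hK).ne).symm

/-- Dynkin induction from the closed sets; cutting down to a compact set keeps measures finite, so
that complements become differences. -/
theorem measurable_measure_inter {K : Set α} (hK : IsCompact K) {B : Set α}
    (hB : MeasurableSet B) :
    Measurable fun γ : RadonCountingMeasure α => γ.toMeasure (B ∩ K) := by
  have hgen : (inferInstance : MeasurableSpace α) = .generateFrom {s | IsClosed s} :=
    BorelSpace.measurable_eq.trans borel_eq_generateFrom_isClosed
  induction B, hB using MeasurableSpace.induction_on_inter hgen isPiSystem_isClosed with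
  | empty => simp
  | basic F hF => exact measurable_measure_of_isCompact (hK.inter_left hF)
  | compl B hB ih =>
    have : ∀ γ : RadonCountingMeasure α,
        γ.toMeasure (Bᶜ ∩ K) = γ.toMeasure K - γ.toMeasure (B ∩ K) := fun γ => by
      rw [← measure_sdiff inter_subset_right (hB.inter hK.measurableSet).nullMeasurableSet
        ((measure_mono inter_subset_right).trans_lt (γ.isRadon.finiteOnCompacts _ hK)).ne]
      congr 1
      ext x
      simp only [mem_inter_iff, mem_compl_iff, Set.mem_sdiff]
      tauto
    simp_rw [this]
    exact (measurable_measure_of_isCompact hK).sub ih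
  | iUnion f hd hf ih =>
    have : ∀ γ : RadonCountingMeasure α,
        γ.toMeasure ((⋃ i, f i) ∩ K) = ∑' i, γ.toMeasure (f i ∩ K) := fun γ => by
      rw [iUnion_inter, measure_iUnion
        (fun i j hij => (hd hij).mono inter_subset_left inter_subset_left)
        fun i => (hf i).inter hK.measurableSet]
    simp_rw [this]
    exact Measurable.tsum ih

theorem measurable_measure {B : Set α} (hB : MeasurableSet B) :
    Measurable fun γ : RadonCountingMeasure α => γ.toMeasure B := by
  have : ∀ γ : RadonCountingMeasure α,
      γ.toMeasure B = ⨆ n, γ.toMeasure (B ∩ compactCovering α n) := fun γ => by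
    rw [← Monotone.measure_iUnion fun i j hij =>
      inter_subset_inter_right _ (compactCovering_subset α hij), ← inter_iUnion,
      iUnion_compactCovering, inter_univ]
  simp_rw [this]
  exact Measurable.iSup fun n => measurable_measure_inter (isCompact_compactCovering α n) hB

/-- Integrality upgrades convergence of measures to zero into eventual vanishing. -/
theorem measure_eq_zero_of_lt_one {α : Type*} [TopologicalSpace α] [MeasurableSpace α]
    (γ : RadonCountingMeasure α) {C : Set α} (hC : MeasurableSet C) (h : γ.toMeasure C < 1) :
    γ.toMeasure C = 0 := by
  obtain ⟨n, hn⟩ := γ.isCounting C hC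
  rw [hn] at h ⊢
  have : n < 1 := by exact_mod_cast h
  simpa [Order.lt_one_iff] using this

/-- The number of points in a set, with junk value `0` if it is infinite. -/
noncomputable def count {α : Type*} [TopologicalSpace α] [MeasurableSpace α]
    (γ : RadonCountingMeasure α) (C : Set α) : ℕ := ⌊(γ.toMeasure C).toReal⌋₊

theorem coe_count {α : Type*} [TopologicalSpace α] [MeasurableSpace α]
    (γ : RadonCountingMeasure α) {C : Set α} (hC : MeasurableSet C) (h : γ.toMeasure C ≠ ∞) :
    (γ.count C : ℝ≥0∞) = γ.toMeasure C := by
  obtain ⟨n, hn⟩ := γ.isCounting C hC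
  have hn' : n ≠ ⊤ := by rintro rfl; simp [hn] at h
  lift n to ℕ using hn'
  simp [count, hn]

theorem measurable_count {B : Set α} (hB : MeasurableSet B) :
    Measurable fun γ : RadonCountingMeasure α => γ.count B :=
  Nat.measurable_floor.comp (measurable_measure hB).ennreal_toReal

end RadonCountingMeasure

end Measurability

/-! ### Bounded times and the failure time -/

section UpTo

variable {Ω : Set (EuclideanSpace ℝ (Fin 3))}

instance instProperSpaceClosure : ProperSpace ↥(closure Ω) := .of_isClosed isClosed_closure

theorem isClosed_upTo (t : ℝ) : IsClosed (upTo Ω t) :=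
  isClosed_le (by fun_prop) continuous_const

theorem upTo_mono : Monotone (upTo Ω) := fun _ _ hst _ hc => le_trans hc hst

theorem isCompact_upTo (hΩ : Bornology.IsBounded Ω) (t : ℝ) : IsCompact (upTo Ω t) := by
  have : CompactSpace ↥(closure Ω) := isCompact_iff_compactSpace.1 hΩ.isCompact_closure
  refine (isCompact_univ.prod (isCompact_Icc (a := 0) (b := t.toNNReal))).of_isClosed_subset
    (isClosed_upTo t) fun c hc => ⟨mem_univ _, zero_le, ?_⟩
  exact NNReal.le_toNNReal_of_coe_le hc

/-- The infimum is attained: `upTo Ω t` is the decreasing intersection of the sets `upTo Ω (t +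
1/(n+1))` of finite measure. If `γ` vanishes on it, then by integrality `γ` already vanishes up to
some `t + δ`, whence `τ ≥ t + δ`. -/
theorem failureTime_le_iff (hΩ : Bornology.IsBounded Ω) (γ : RadonCountingMeasure (Config Ω))
    (t : ℝ≥0) : failureTime γ ≤ t ↔ 0 < γ.toMeasure (upTo Ω t) := by
  refine ⟨fun h => ?_, fun h => sInf_le ⟨t, h, rfl⟩⟩
  by_contra h0
  have h0 : γ.toMeasure (upTo Ω t) = 0 := nonpos_iff_eq_zero.1 (not_lt.1 h0)
  have hInter : upTo Ω t = ⋂ n : ℕ, upTo Ω (t + 1 / (n + 1 : ℝ)) := by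
    refine subset_antisymm (subset_iInter fun n => upTo_mono (by simp; positivity)) fun c hc => ?_
    refine ge_of_tendsto' (x := atTop) (f := fun n : ℕ => (t : ℝ) + 1 / (n + 1 : ℝ)) ?_
      (mem_iInter.1 hc)
    simpa using tendsto_one_div_add_atTop_nhds_zero_nat.const_add (t : ℝ)
  have hlim := tendsto_measure_iInter_atTop (μ := γ.toMeasure)
    (s := fun n : ℕ => upTo Ω (t + 1 / (n + 1 : ℝ)))
    (fun n => (isClosed_upTo _).measurableSet.nullMeasurableSet)
    (fun m n hmn => upTo_mono (by gcongr))
    ⟨0, (γ.isRadon.finiteOnCompacts _ (isCompact_upTo hΩ _)).ne⟩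
  rw [← hInter, h0] at hlim
  obtain ⟨n, hn⟩ := (hlim.eventually (Iio_mem_nhds zero_lt_one)).exists
  have hn0 := γ.measure_eq_zero_of_lt_one (isClosed_upTo _).measurableSet hn
  set δ : ℝ≥0 := 1 / (n + 1) with hδ
  have hδ0 : 0 < δ := by positivity
  have hn0 : γ.toMeasure (upTo Ω (t + δ : ℝ≥0)) = 0 := by simpa [hδ] using hn0
  have : ((t + δ : ℝ≥0) : ℝ≥0∞) ≤ failureTime γ := by
    refine le_sInf ?_
    rintro _ ⟨s, hs, rfl⟩
    by_contra hlt
    have hst : s ≤ t + δ := ENNReal.coe_le_coe.1 (not_le.1 hlt).le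
    exact hs.ne' (measure_mono_null (upTo_mono (by exact_mod_cast hst)) hn0)
  have h2 : t + δ ≤ t := by exact_mod_cast this.trans h
  exact absurd h2 (by simpa using hδ0.ne')

theorem measurable_failureTime (hΩ : Bornology.IsBounded Ω) :
    Measurable (failureTime (Ω := Ω)) := by
  refine measurable_of_Iic fun a => ?_
  induction a with
  | top => simp
  | coe t =>
    have : failureTime (Ω := Ω) ⁻¹' Iic (t : ℝ≥0∞) = {γ | 0 < γ.toMeasure (upTo Ω t)} := by
      ext γ
      exact failureTime_le_iff hΩ γ t
    rw [this]
    exact measurableSet_lt measurable_const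
      (RadonCountingMeasure.measurable_measure (isClosed_upTo _).measurableSet)

end UpTo

/-! ### Continuity of Poisson probabilities in the rate -/

section PoissonProbability

/-- The Poisson probability of `n` at rate `x`, as a function of `x` in `[0, ∞]`. -/
noncomputable def poissonProbability (n : ℕ) (x : ℝ≥0∞) : ℝ≥0∞ :=
  EReal.exp (-(x : EReal)) * x ^ n / ((n ! : ℕ) : ℝ≥0∞)

theorem poissonProbability_of_ne_top (n : ℕ) {x : ℝ≥0∞} (hx : x ≠ ∞) :
    poissonProbability n x = ENNReal.ofReal (Real.exp (-x.toReal) * x.toReal ^ n / n !) := by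
  lift x to ℝ≥0 using hx
  rw [poissonProbability, ENNReal.ofReal_div_of_pos (by positivity),
    ENNReal.ofReal_mul (Real.exp_nonneg _), ENNReal.ofReal_pow (by positivity)]
  simp only [ENNReal.coe_toReal, ENNReal.ofReal_coe_nnreal, ENNReal.ofReal_natCast]
  congr 2

theorem poissonProbability_top (n : ℕ) : poissonProbability n ∞ = 0 := by
  simp [poissonProbability]

/-- Allows finite intensities to grow to `∞`, where the decay of `x ^ n * exp(-x)` matches the value
zero. -/
theorem tendsto_poissonProbability {ι : Type*} {l : Filter ι} {a : ι → ℝ≥0∞} {x : ℝ≥0∞} (n : ℕ)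
    (ha : ∀ i, a i ≠ ∞) (h : Tendsto a l (𝓝 x)) :
    Tendsto (fun i => poissonProbability n (a i)) l (𝓝 (poissonProbability n x)) := by
  simp_rw [poissonProbability_of_ne_top n (ha _)]
  by_cases hx : x = ∞
  · subst hx
    have h1 : Tendsto (fun i => (a i).toReal) l atTop := by
      refine tendsto_atTop.2 fun b => ?_
      filter_upwards [h.eventually (lt_mem_nhds (ENNReal.ofReal_lt_top (r := b)))] with i hi
      exact (ENNReal.ofReal_le_iff_le_toReal (ha i)).1 hi.le
    have h2 := ((Real.tendsto_pow_mul_exp_neg_atTop_nhds_zero n).comp h1).div_const (n ! : ℝ)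
    rw [poissonProbability_top, ← ENNReal.ofReal_zero]
    refine ENNReal.tendsto_ofReal ?_
    simpa [mul_comm] using h2
  · rw [poissonProbability_of_ne_top n hx]
    have h1 : Tendsto (fun i => (a i).toReal) l (𝓝 x.toReal) := (ENNReal.tendsto_toReal hx).comp h
    exact ENNReal.tendsto_ofReal
      ((((Real.continuous_exp.tendsto _).comp h1.neg).mul (h1.pow n)).div_const _)

end PoissonProbability

/-! ### Fine partitions into rarely hit pieces -/

section Partition

variable {α : Type*} [MetricSpace α] [ProperSpace α] [MeasurableSpace α] [BorelSpace α]
  {X : Type*} [MeasurableSpace X] {P : Measure X} [IsProbabilityMeasure P]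
  {γ : X → RadonCountingMeasure α}

theorem measurableSet_measure_ne_zero (hγ : Measurable γ) {B : Set α} (hB : MeasurableSet B) :
    MeasurableSet {ω | (γ ω).toMeasure B ≠ 0} :=
  ((RadonCountingMeasure.measurable_measure hB).comp hγ) (measurableSet_singleton 0).compl

theorem setOf_measure_ne_zero_subset {X α : Type*} [TopologicalSpace α] [MeasurableSpace α]
    {γ : X → RadonCountingMeasure α} {A B : Set α} (h : A ⊆ B) :
    {ω | (γ ω).toMeasure A ≠ 0} ⊆ {ω | (γ ω).toMeasure B ≠ 0} := by
  intro ω hω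
  rw [mem_ofPred_eq] at hω ⊢
  exact fun h0 => hω (measure_mono_null h h0)

/-- Closed balls shrink to `{c}`. By integrality the events that they are hit converge pointwise to
the event that `c` is hit, which is null. -/
theorem exists_ball_real_le (hγ : Measurable γ) {c : α}
    (hc : P {ω | 0 < (γ ω).toMeasure {c}} = 0) {ε : ℝ} (hε : 0 < ε) :
    ∃ r, 0 < r ∧ r ≤ ε ∧ P.real {ω | (γ ω).toMeasure (Metric.ball c r) ≠ 0} ≤ ε := by
  let r : ℕ → ℝ := fun n => ε / (n + 1)
  have hr : ∀ n, 0 < r n := fun n => by positivity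
  have hr0 : Tendsto r atTop (𝓝 0) := by
    simpa [r, div_eq_mul_inv] using tendsto_one_div_add_atTop_nhds_zero_nat.const_mul ε
  have hanti : Antitone r := fun m n hmn => by dsimp only [r]; gcongr
  have hInter : (⋂ n, Metric.closedBall c (r n)) = {c} := by
    ext x
    simp only [mem_iInter, Metric.mem_closedBall, mem_singleton_iff]
    refine ⟨fun h => dist_le_zero.1 (ge_of_tendsto' hr0 h), ?_⟩
    rintro rfl n
    simpa using (hr n).le
  have hlim : Tendsto (fun n => P {ω | (γ ω).toMeasure (Metric.closedBall c (r n)) ≠ 0}) atTop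
      (𝓝 (P {ω | (γ ω).toMeasure {c} ≠ 0})) := by
    refine tendsto_measure_of_ae_tendsto_indicator_of_isFiniteMeasure _
      (measurableSet_measure_ne_zero hγ (measurableSet_singleton c))
      (fun n => measurableSet_measure_ne_zero hγ measurableSet_closedBall) (ae_of_all _ fun ω => ?_)
    have h := tendsto_measure_iInter_atTop (μ := (γ ω).toMeasure)
      (s := fun n => Metric.closedBall c (r n))
      (fun n => measurableSet_closedBall.nullMeasurableSet)
      (fun m n hmn => Metric.closedBall_subset_closedBall (hanti hmn))
      ⟨0, ((γ ω).isRadon.finiteOnCompacts _ (isCompact_closedBall c _)).ne⟩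
    rw [hInter] at h
    by_cases h0 : (γ ω).toMeasure {c} = 0
    · rw [h0] at h
      filter_upwards [h.eventually (Iio_mem_nhds zero_lt_one)] with n hn
      simp [h0, (γ ω).measure_eq_zero_of_lt_one measurableSet_closedBall hn]
    · refine Eventually.of_forall fun n => ?_
      simp only [mem_ofPred_eq, ne_eq, h0, not_false_eq_true, iff_true]
      exact fun h1 => h0 (measure_mono_null (by simpa using (hr n).le) h1)
  have hc' : P {ω | (γ ω).toMeasure {c} ≠ 0} = 0 := by simpa [pos_iff_ne_zero] using hc
  rw [hc'] at hlim
  obtain ⟨n, hn⟩ := (hlim.eventually (Iio_mem_nhds (ENNReal.ofReal_pos.2 hε))).exists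
  refine ⟨r n, hr n, div_le_self hε.le (by linarith [n.cast_nonneg (α := ℝ)]), ?_⟩
  refine ENNReal.toReal_le_of_le_ofReal hε.le ((measure_mono ?_).trans (le_of_lt hn))
  exact setOf_measure_ne_zero_subset Metric.ball_subset_closedBall

/-- A finite subcover by the balls of `exists_ball_real_le`, made disjoint; passing to subsets
preserves both smallness bounds. -/
theorem exists_fin_partition (hγ : Measurable γ)
    (hna : ∀ c, P {ω | 0 < (γ ω).toMeasure {c}} = 0) {K : Set α} (hK : IsCompact K) {ε : ℝ}
    (hε : 0 < ε) :
    ∃ (k : ℕ) (D : Fin k → Set α), (∀ i, MeasurableSet (D i)) ∧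
      Pairwise (Function.onFun Disjoint D) ∧ K ⊆ ⋃ i, D i ∧
      (∀ i, ∀ x ∈ D i, ∀ y ∈ D i, dist x y < 2 * ε) ∧
      ∀ i, P.real {ω | (γ ω).toMeasure (D i) ≠ 0} ≤ ε := by
  choose r hr0 hrε hr using fun c => exists_ball_real_le hγ (hna c) hε
  obtain ⟨t, -, ht⟩ := hK.elim_nhds_subcover (fun c => Metric.ball c (r c))
    fun c _ => Metric.ball_mem_nhds c (hr0 c)
  let f : Fin t.card → α := fun i => t.equivFin.symm i
  let U : Fin t.card → Set α := fun i => Metric.ball (f i) (r (f i))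
  have hsub : ∀ i, disjointed U i ⊆ U i := disjointed_subset U
  refine ⟨t.card, disjointed U, fun i => ?_, disjoint_disjointed U, ?_, fun i x hx y hy => ?_,
    fun i => ?_⟩
  · rw [disjointed_eq_inter_compl]
    exact measurableSet_ball.inter (.iInter fun j => .iInter fun _ => measurableSet_ball.compl)
  · rw [iUnion_disjointed]
    refine ht.trans (iUnion₂_subset fun c hc => ?_)
    refine subset_iUnion_of_subset (t.equivFin ⟨c, hc⟩) ?_
    simp [U, f]
  · have h1 := Metric.mem_ball.1 (hsub i hx)
    have h2 := Metric.mem_ball'.1 (hsub i hy)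
    linarith [dist_triangle x (f i) y, hrε (f i)]
  · exact (measureReal_mono (setOf_measure_ne_zero_subset (hsub i))).trans (hr (f i))

end Partition

/-! ### The Poisson law of the counts -/

section Poisson

variable {Ω : Set (EuclideanSpace ℝ (Fin 3))} {X : Type*} [MeasurableSpace X] {P : Measure X}
  {γ : X → RadonCountingMeasure (Config Ω)}

/-- The intensity measure `C ↦ E (γ C)` of a point process. -/
noncomputable def intensity (P : Measure X) (γ : X → RadonCountingMeasure (Config Ω)) :
    Measure (Config Ω) :=
  P.bind fun ω => (γ ω).toMeasure

theorem intensity_apply (hγ : Measurable γ) {B : Set (Config Ω)} (hB : MeasurableSet B) :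
    intensity P γ B = ∫⁻ ω, (γ ω).toMeasure B ∂P :=
  Measure.bind_apply hB (Measure.measurable_of_measurable_coe _ fun _ hs =>
    (RadonCountingMeasure.measurable_measure hs).comp hγ).aemeasurable

/-- Finitely many distinct atoms have a positive minimal distance `δ`, so a set whose points are
less than `δ` apart contains at most one of them. -/
theorem IsSimple.exists_forall_measure_le_one {γ : RadonCountingMeasure (Config Ω)}
    (hγ : IsSimple γ) (t : ℝ≥0) :
    ∃ δ > 0, ∀ B : Set (Config Ω), MeasurableSet B → B ⊆ upTo Ω t →
      (∀ x ∈ B, ∀ y ∈ B, dist x y < δ) → γ.toMeasure B ≤ 1 := by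
  classical
  obtain ⟨S, hS⟩ := hγ t
  obtain ⟨δ, hδ, hsep⟩ : ∃ δ > 0, ∀ x ∈ S, ∀ y ∈ S, dist x y < δ → x = y := by
    have hfin : ∀ᶠ δ in 𝓝[>] (0 : ℝ), ∀ p ∈ S ×ˢ S, dist p.1 p.2 < δ → p.1 = p.2 := by
      refine (Finset.eventually_all _).2 fun p _ => ?_
      by_cases hp : p.1 = p.2
      · exact Eventually.of_forall fun _ _ => hp
      · filter_upwards [Ioo_mem_nhdsGT (dist_pos.2 hp)] with δ hδ h
        exact absurd h (not_lt.2 hδ.2.le)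
    obtain ⟨δ, h1, h2⟩ := (hfin.and self_mem_nhdsWithin).exists
    exact ⟨δ, h2, fun x hx y hy => h1 (x, y) (Finset.mk_mem_product hx hy)⟩
  refine ⟨δ, hδ, fun B hB hBt hdist => ?_⟩
  have h1 : γ.toMeasure B = ∑ c ∈ S, B.indicator 1 c := by
    rw [← Measure.restrict_eq_self γ.toMeasure hBt, hS, Measure.finsetSum_apply]
    simp_rw [Measure.dirac_apply' _ hB]
  rw [h1]
  by_cases hne : ∃ c ∈ S, c ∈ B
  · obtain ⟨c, hcS, hcB⟩ := hne
    rw [Finset.sum_eq_single_of_mem c hcS]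
    · simp [hcB]
    · intro d hd hdc
      refine indicator_of_notMem (fun hdB => hdc ?_) _
      exact hsep d hd c hcS (hdist d hdB c hcB)
  · push Not at hne
    rw [Finset.sum_eq_zero fun c hc => indicator_of_notMem (hne c hc) _]
    exact zero_le

variable [IsProbabilityMeasure P]

theorem intensity_ne_top_and_map_count (hΩ : Bornology.IsBounded Ω)
    (hγ : IsCrackInitiationProcess P γ) (hind : HasIndependentIncrements P γ) {t : ℝ≥0}
    {B : Set (Config Ω)} (hB : MeasurableSet B) (hBt : B ⊆ upTo Ω t) :
    intensity P γ B ≠ ∞ ∧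
      P.map (fun ω => (γ ω).count B) = poissonMeasure (intensity P γ B).toNNReal := by
  have hε : ∀ m : ℕ, 0 < (1 : ℝ) / (m + 1) := fun m => Nat.one_div_pos_of_nat
  have hfin : ∀ A ⊆ B, ∀ ω, (γ ω).toMeasure A ≠ ∞ := fun A hA ω =>
    ((measure_mono (hA.trans hBt)).trans_lt
      ((γ ω).isRadon.finiteOnCompacts _ (isCompact_upTo hΩ t))).ne
  choose k D hDm hDd hDc hDdist hDp using fun m : ℕ =>
    exists_fin_partition hγ.measurable hγ.nonAtomic (isCompact_upTo hΩ (t : ℝ)) (hε m)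
  have hm : ∀ m i, MeasurableSet (B ∩ D m i) := fun m i => hB.inter (hDm m i)
  have hd : ∀ m, Pairwise (Function.onFun Disjoint fun i => B ∩ D m i) := fun m i j hij =>
    (hDd m hij).mono inter_subset_right inter_subset_right
  have hcount : ∀ ω, ((γ ω).count B : ℝ≥0∞) = (γ ω).toMeasure B := fun ω =>
    (γ ω).coe_count hB (hfin B subset_rfl ω)
  -- Row `m` consists of the counts of `B` in the pieces of the partition at scale `1/(m+1)`.
  have key := map_eq_poissonMeasure_of_nullArray (P := P) (N := fun ω => (γ ω).count B) (k := k)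
    (ξ := fun m i ω => (γ ω).count (B ∩ D m i)) (ε := fun m : ℕ => (1 : ℝ) / (m + 1))
    ((RadonCountingMeasure.measurable_count hB).comp hγ.measurable)
    (fun m i => (RadonCountingMeasure.measurable_count (hm m i)).comp hγ.measurable)
    (fun m => (hind (k m) _ (hm m) (hd m)).comp (fun _ x => ⌊x.toReal⌋₊)
      fun _ => Nat.measurable_floor.comp ENNReal.measurable_toReal)
    (fun m ω => ?_) ?_ tendsto_one_div_add_atTop_nhds_zero_nat (fun m i => ?_)
  · simp_rw [hcount, ← intensity_apply hγ.measurable hB] at key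
    exact key
  · have h1 : B = ⋃ i, B ∩ D m i := by
      rw [← inter_iUnion, inter_eq_left.2 (hBt.trans (hDc m))]
    have h2 : ((γ ω).count B : ℝ≥0∞) = ((∑ i, (γ ω).count (B ∩ D m i) : ℕ) : ℝ≥0∞) := by
      rw [hcount, Nat.cast_sum]
      simp_rw [(γ ω).coe_count (hm m _) (hfin _ inter_subset_left ω)]
      conv_lhs => rw [h1]
      rw [measure_iUnion (hd m) (hm m), tsum_fintype]
    exact_mod_cast h2
  -- The separation `δ` depends on `ω`, so the row from which the entries are at most one does too;
  -- the law of rare events asks for no uniformity.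
  · filter_upwards [hγ.simple] with ω hω
    obtain ⟨δ, hδ, hle⟩ := hω.exists_forall_measure_le_one t
    have h2 : Tendsto (fun m : ℕ => 2 * ((1 : ℝ) / (m + 1))) atTop (𝓝 0) := by
      simpa using tendsto_one_div_add_atTop_nhds_zero_nat.const_mul (2 : ℝ)
    filter_upwards [h2.eventually (Iio_mem_nhds hδ)] with m hmδ i
    have h3 := hle (B ∩ D m i) (hm m i) (inter_subset_left.trans hBt)
      fun x hx y hy => (hDdist m i x hx.2 y hy.2).trans hmδ
    rw [← (γ ω).coe_count (hm m i) (hfin _ inter_subset_left ω)] at h3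
    exact_mod_cast h3
  · refine (measureReal_mono ((?_ : _ ⊆ {ω | (γ ω).toMeasure (B ∩ D m i) ≠ 0}).trans
      (setOf_measure_ne_zero_subset inter_subset_right))).trans (hDp m i)
    intro ω hω
    rw [mem_ofPred_eq] at hω ⊢
    exact fun h0 => hω (by simp [RadonCountingMeasure.count, h0])

theorem measure_eq_poissonProbability_of_subset_upTo (hΩ : Bornology.IsBounded Ω)
    (hγ : IsCrackInitiationProcess P γ) (hind : HasIndependentIncrements P γ) {t : ℝ≥0}
    {B : Set (Config Ω)} (hB : MeasurableSet B) (hBt : B ⊆ upTo Ω t) (n : ℕ) :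
    P {ω | (γ ω).toMeasure B = n} = poissonProbability n (intensity P γ B) := by
  obtain ⟨hfin, hmap⟩ := intensity_ne_top_and_map_count hΩ hγ hind hB hBt
  have h := poissonMeasure_singleton (intensity P γ B).toNNReal n
  have hmeas : Measurable fun ω => (γ ω).count B :=
    (RadonCountingMeasure.measurable_count hB).comp hγ.measurable
  rw [← hmap, Measure.map_apply hmeas
    (measurableSet_singleton n)] at h
  rw [ENNReal.coe_toNNReal_eq_toReal, ← poissonProbability_of_ne_top n hfin] at h
  rw [← h]
  congr 1
  ext ω
  rw [mem_ofPred_eq, mem_preimage, mem_singleton_iff, ← (γ ω).coe_count hB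
    ((measure_mono hBt).trans_lt ((γ ω).isRadon.finiteOnCompacts _ (isCompact_upTo hΩ t))).ne]
  exact Nat.cast_inj

/-- Both sides pass to the limit along `C ∩ upTo Ω m`: the left because the indicators of the events
converge pointwise, the right by continuity in the rate. -/
theorem measure_eq_poissonProbability (hΩ : Bornology.IsBounded Ω)
    (hγ : IsCrackInitiationProcess P γ) (hind : HasIndependentIncrements P γ)
    {C : Set (Config Ω)} (hC : MeasurableSet C) (n : ℕ) :
    P {ω | (γ ω).toMeasure C = n} = poissonProbability n (intensity P γ C) := by
  let A : ℕ → Set (Config Ω) := fun m => C ∩ upTo Ω (m : ℝ≥0)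
  have hA : ∀ m, MeasurableSet (A m) := fun m => hC.inter (isClosed_upTo _).measurableSet
  have hmono : Monotone A := fun i j hij => inter_subset_inter_right _ (upTo_mono (by simpa))
  have hU : ⋃ m, A m = C := by
    refine subset_antisymm (iUnion_subset fun m => inter_subset_left) fun c hc => ?_
    obtain ⟨m, hm⟩ := exists_nat_ge (c.2 : ℝ)
    exact mem_iUnion.2 ⟨m, hc, by simpa [upTo] using hm⟩
  have hlim : ∀ μ : Measure (Config Ω), Tendsto (fun m => μ (A m)) atTop (𝓝 (μ C)) := fun μ => by
    simpa only [hU] using! tendsto_measure_iUnion_atTop (μ := μ) hmono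
  have hmeas : ∀ B, MeasurableSet B → MeasurableSet {ω | (γ ω).toMeasure B = n} := fun B hB =>
    ((RadonCountingMeasure.measurable_measure hB).comp hγ.measurable) (measurableSet_singleton _)
  have h1 : Tendsto (fun m => P {ω | (γ ω).toMeasure (A m) = n}) atTop
      (𝓝 (P {ω | (γ ω).toMeasure C = n})) := by
    refine tendsto_measure_of_ae_tendsto_indicator_of_isFiniteMeasure _ (hmeas C hC)
      (fun m => hmeas _ (hA m)) (ae_of_all _ fun ω => ?_)
    simp only [mem_ofPred_eq]
    have hω := hlim (γ ω).toMeasure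
    by_cases hn : (γ ω).toMeasure C = n
    · simp only [hn, iff_true]
      -- For a positive value `n + 1`, the integers `γ(A m)` eventually exceed `n` and never exceed
      -- `n + 1`; for the value zero monotonicity is enough.
      rcases n with _ | n
      · rw [Nat.cast_zero] at hn ⊢
        exact Eventually.of_forall fun m => measure_mono_null inter_subset_left hn
      · rw [hn] at hω
        filter_upwards [hω.eventually (lt_mem_nhds (show (n : ℝ≥0∞) < ((n + 1 : ℕ) : ℝ≥0∞) by
          exact_mod_cast n.lt_succ_self))] with m hm
        have hle : (γ ω).toMeasure (A m) ≤ ((n + 1 : ℕ) : ℝ≥0∞) :=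
          hn ▸ measure_mono inter_subset_left
        have hne : (γ ω).toMeasure (A m) ≠ ∞ := ne_top_of_le_ne_top (by simp) hle
        rw [← (γ ω).coe_count (hA m) hne] at hm hle ⊢
        have h1 : n < (γ ω).count (A m) := by exact_mod_cast hm
        have h2 : (γ ω).count (A m) ≤ n + 1 := by exact_mod_cast hle
        rw [show (γ ω).count (A m) = n + 1 by omega]
    · simp only [hn, iff_false]
      exact hω.eventually_ne hn
  simp_rw [measure_eq_poissonProbability_of_subset_upTo hΩ hγ hind (hA _) inter_subset_right] at h1
  exact tendsto_nhds_unique h1 (tendsto_poissonProbability n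
    (fun m => (intensity_ne_top_and_map_count hΩ hγ hind (hA m) inter_subset_right).1) (hlim _))

theorem isRadon_intensity (hΩ : Bornology.IsBounded Ω)
    (hγ : IsCrackInitiationProcess P γ) (hind : HasIndependentIncrements P γ) :
    IsRadon (intensity P γ) := by
  have hK : ∀ K : Set (Config Ω), IsCompact K → intensity P γ K < ∞ := fun K hK => by
    obtain ⟨t, ht⟩ := (hK.image continuous_snd).bddAbove
    exact (intensity_ne_top_and_map_count hΩ hγ hind hK.measurableSet (t := t)
      fun c hc => NNReal.coe_le_coe.2 (ht ⟨c, hc, rfl⟩)).1.lt_top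
  have : IsFiniteMeasureOnCompacts (intensity P γ) := ⟨hK⟩
  exact ⟨inferInstance, hK⟩

theorem isPoissonPointProcess_intensity (hΩ : Bornology.IsBounded Ω)
    (hγ : IsCrackInitiationProcess P γ) (hind : HasIndependentIncrements P γ) :
    IsPoissonPointProcess P γ (intensity P γ) :=
  ⟨hγ.measurable, isRadon_intensity hΩ hγ hind,
    fun _ hC n => measure_eq_poissonProbability hΩ hγ hind hC n, hind⟩

end Poisson

/-! ### Uniqueness of the intensity, distribution and hazard rate of the failure time -/

section FailureTime

variable {Ω : Set (EuclideanSpace ℝ (Fin 3))} {X : Type*} [MeasurableSpace X] {P : Measure X}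
  {γ : X → RadonCountingMeasure (Config Ω)} {ρ ρ' : Measure (Config Ω)}

theorem IsPoissonPointProcess.measurableSet_measure_eq_zero (h : IsPoissonPointProcess P γ ρ)
    {C : Set (Config Ω)} (hC : MeasurableSet C) : MeasurableSet {ω | (γ ω).toMeasure C = 0} :=
  ((RadonCountingMeasure.measurable_measure hC).comp h.measurable) (measurableSet_singleton 0)

theorem IsPoissonPointProcess.measure_eq_zero (h : IsPoissonPointProcess P γ ρ)
    {C : Set (Config Ω)} (hC : MeasurableSet C) :
    P {ω | (γ ω).toMeasure C = 0} = EReal.exp (-(ρ C : EReal)) := by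
  simpa using h.poisson C hC 0

/-- Void probabilities suffice, since `x ↦ exp(-x)` is injective on `[0, ∞]`. -/
theorem IsPoissonPointProcess.intensity_unique (h : IsPoissonPointProcess P γ ρ)
    (h' : IsPoissonPointProcess P γ ρ') : ρ = ρ' := by
  ext C hC
  have := (h.measure_eq_zero hC).symm.trans (h'.measure_eq_zero hC)
  exact EReal.coe_ennreal_injective (neg_injective (EReal.exp_strictMono.injective this))

variable [IsProbabilityMeasure P]

theorem IsPoissonPointProcess.singleton_eq_zero (h : IsPoissonPointProcess P γ ρ) {c : Config Ω}
    (hc : P {ω | 0 < (γ ω).toMeasure {c}} = 0) : ρ {c} = 0 := by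
  have h1 : P {ω | (γ ω).toMeasure {c} = 0} = 1 := by
    rw [← prob_compl_eq_zero_iff
      (h.measurableSet_measure_eq_zero (measurableSet_singleton c))]
    convert hc using 2
    ext ω
    simp [pos_iff_ne_zero]
  rw [h.measure_eq_zero (measurableSet_singleton c), ← EReal.exp_zero] at h1
  have h2 := EReal.neg_eq_zero_iff.1 (EReal.exp_strictMono.injective h1)
  exact_mod_cast h2

theorem IsPoissonPointProcess.distributionFunction_failureTime (hΩ : Bornology.IsBounded Ω)
    (h : IsPoissonPointProcess P γ ρ) (t : ℝ≥0) :
    distributionFunction P (fun ω => failureTime (γ ω)) t =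
      1 - Real.exp (-ρ.real (upTo Ω t)) := by
  have hm : MeasurableSet (upTo Ω (t : ℝ)) := (isClosed_upTo _).measurableSet
  have h1 : {ω | failureTime (γ ω) ≤ t} = {ω | (γ ω).toMeasure (upTo Ω t) = 0}ᶜ := by
    ext ω
    rw [mem_ofPred_eq, failureTime_le_iff hΩ, pos_iff_ne_zero]
    rfl
  have hfin := (h.isRadon.finiteOnCompacts _ (isCompact_upTo hΩ (t : ℝ))).ne
  rw [distributionFunction, h1, probReal_compl_eq_one_sub
    (h.measurableSet_measure_eq_zero hm), measureReal_def, h.measure_eq_zero hm, measureReal_def]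
  lift ρ (upTo Ω t) to ℝ≥0 using hfin with x
  have : (-(((x : ℝ≥0∞) : EReal))) = ((-(x : ℝ) : ℝ) : EReal) := rfl
  rw [this, EReal.exp_coe, ENNReal.toReal_ofReal (Real.exp_nonneg _), ENNReal.coe_toReal]

theorem IsPoissonPointProcess.hasHazardRateAt_failureTime (hΩ : Bornology.IsBounded Ω)
    (hρ : IsPoissonPointProcess P γ ρ) {t : ℝ≥0} {h : ℝ}
    (hd : HasDerivWithinAt (fun s : ℝ => ρ.real (upTo Ω s)) h (Ici 0) t) :
    HasHazardRateAt P (fun ω => failureTime (γ ω)) h t := by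
  set H : ℝ → ℝ := fun s => ρ.real (upTo Ω s)
  set τ : X → ℝ≥0∞ := fun ω => failureTime (γ ω)
  have hτm : Measurable τ := (measurable_failureTime hΩ).comp hρ.measurable
  have hcdf : ∀ s : ℝ≥0, P.real {ω | τ ω ≤ s} = 1 - Real.exp (-H s) := fun s =>
    hρ.distributionFunction_failureTime hΩ s
  have hle : ∀ s : ℝ≥0∞, MeasurableSet {ω | τ ω ≤ s} := fun s => measurableSet_le hτm
    measurable_const
  have hgt : {ω | (t : ℝ≥0∞) < τ ω} = {ω | τ ω ≤ t}ᶜ := by ext ω; simp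
  have hS : P.real {ω | (t : ℝ≥0∞) < τ ω} = Real.exp (-H t) := by
    rw [hgt, probReal_compl_eq_one_sub (hle _), hcdf]
    ring
  refine ⟨ENNReal.toReal_pos_iff.1 (hS ▸ Real.exp_pos _ : 0 < P.real _) |>.1, ?_⟩
  have hcond : ∀ Δ : ℝ, 0 < Δ →
      (ProbabilityTheory.cond P {ω | (t : ℝ≥0∞) < τ ω}).real
        {ω | τ ω ∈ Icc (t : ℝ≥0∞) (t + ENNReal.ofReal Δ)} =
      Real.exp (H t) * (Real.exp (-H t) - Real.exp (-H (t + Δ))) := fun Δ hΔ => by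
    have hcast : (t : ℝ≥0∞) + ENNReal.ofReal Δ = ((t + Δ.toNNReal : ℝ≥0) : ℝ≥0∞) := by
      rw [ENNReal.coe_add]; rfl
    -- Conditioning on `τ > t` discards the left endpoint of the closed interval, leaving a
    -- difference of two values of the distribution function.
    have hset : {ω | (t : ℝ≥0∞) < τ ω} ∩ {ω | τ ω ∈ Icc (t : ℝ≥0∞) (t + ENNReal.ofReal Δ)} =
        {ω | τ ω ≤ (t + Δ.toNNReal : ℝ≥0)} \ {ω | τ ω ≤ t} := by
      ext ω
      rw [hcast]
      simp only [mem_inter_iff, mem_ofPred_eq, mem_Icc, Set.mem_sdiff, not_le]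
      exact ⟨fun h => ⟨h.2.2, h.1⟩, fun h => ⟨h.2, h.2.le, h.1⟩⟩
    have hm : MeasurableSet {ω | τ ω ∈ Icc (t : ℝ≥0∞) (t + ENNReal.ofReal Δ)} :=
      hτm measurableSet_Icc
    rw [measureReal_def, ProbabilityTheory.cond_apply' hm, hset, ENNReal.toReal_mul,
      ENNReal.toReal_inv, ← measureReal_def, ← measureReal_def, hS, measureReal_sdiff ?_ (hle _),
      hcdf, hcdf, Real.exp_neg, inv_inv, NNReal.coe_add, Real.coe_toNNReal _ hΔ.le]
    · ring
    · intro ω hω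
      rw [mem_ofPred_eq] at hω ⊢
      exact hω.trans (by simp)
  -- The difference quotient of `s ↦ -exp(H t) exp(-H s)` at `t` is exactly the conditional
  -- probability divided by `Δ`; its derivative there is `h` because the exponentials cancel.
  have hder : HasDerivWithinAt (fun s => Real.exp (H t) * -Real.exp (-H s)) h (Ioi (t : ℝ)) t := by
    have h1 := ((hd.mono (Ioi_subset_Ici t.2)).fun_neg.exp.fun_neg).const_mul (Real.exp (H t))
    have h2 : Real.exp (H t) * -(Real.exp (-H t) * -h) = h := by
      rw [mul_neg, mul_neg, mul_neg, neg_neg, ← mul_assoc, ← Real.exp_add, add_neg_cancel, Real.exp_zero, one_mul]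
    rwa [h2] at h1
  have hslope := (hasDerivWithinAt_iff_tendsto_slope' (by simp)).1 hder
  have hshift : Tendsto (fun Δ : ℝ => (t : ℝ) + Δ) (𝓝[>] 0) (𝓝[>] (t : ℝ)) := by
    refine tendsto_nhdsWithin_iff.2 ⟨?_, ?_⟩
    · have : Tendsto (fun Δ : ℝ => (t : ℝ) + Δ) (𝓝 0) (𝓝 (t + 0)) := tendsto_id.const_add _
      rw [add_zero] at this
      exact this.mono_left nhdsWithin_le_nhds
    · filter_upwards [self_mem_nhdsWithin] with Δ hΔ
      simpa using hΔ
  refine (hslope.comp hshift).congr' ?_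
  filter_upwards [self_mem_nhdsWithin] with Δ hΔ
  rw [hcond Δ hΔ, Function.comp_apply, slope_def_field, add_sub_cancel_left]
  ring

end FailureTime

end CrackInitiation

theorem corollary2p4
    (Ω : Set (EuclideanSpace ℝ (Fin 3))) (hΩ_open : IsOpen Ω) (hΩ_bdd : Bornology.IsBounded Ω)
    {X : Type*} [MeasurableSpace X] (P : Measure X) [IsProbabilityMeasure P]
    (γ : X → CrackInitiation.RadonCountingMeasure (CrackInitiation.Config Ω))
    (hγ : CrackInitiation.IsCrackInitiationProcess P γ)
    (hγ_indep : CrackInitiation.HasIndependentIncrements P γ) :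
    -- the failure time is a random variable
    Measurable (fun ω => CrackInitiation.failureTime (γ ω)) ∧
    -- `γ` is a Poisson point process and has exactly one intensity measure
    (∃! ρ : Measure (CrackInitiation.Config Ω), CrackInitiation.IsPoissonPointProcess P γ ρ) ∧
    ∀ ρ : Measure (CrackInitiation.Config Ω), CrackInitiation.IsPoissonPointProcess P γ ρ →
      (∀ c, ρ {c} = 0) ∧
      (∀ t : ℝ≥0, ρ (CrackInitiation.upTo Ω t) < ∞) ∧
      (∀ t : ℝ≥0,
        CrackInitiation.distributionFunction P (fun ω => CrackInitiation.failureTime (γ ω)) t =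
          1 - Real.exp (-ρ.real (CrackInitiation.upTo Ω t))) ∧
      -- at `t = 0` differentiability is one-sided
      (∀ (t : ℝ≥0) (h : ℝ),
        HasDerivWithinAt (fun s : ℝ => ρ.real (CrackInitiation.upTo Ω s)) h (Ici 0) t →
        CrackInitiation.HasHazardRateAt P (fun ω => CrackInitiation.failureTime (γ ω)) h t) := by
  refine ⟨(CrackInitiation.measurable_failureTime hΩ_bdd).comp hγ.measurable,
    ⟨CrackInitiation.intensity P γ,
      CrackInitiation.isPoissonPointProcess_intensity hΩ_bdd hγ hγ_indep,
      fun ρ hρ => hρ.intensity_unique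
        (CrackInitiation.isPoissonPointProcess_intensity hΩ_bdd hγ hγ_indep)⟩,
    fun ρ hρ => ⟨fun c => hρ.singleton_eq_zero (hγ.nonAtomic c),
      fun t => hρ.isRadon.finiteOnCompacts _ (CrackInitiation.isCompact_upTo hΩ_bdd t),
      fun t => hρ.distributionFunction_failureTime hΩ_bdd t,
      fun t h hd => hρ.hasHazardRateAt_failureTime hΩ_bdd hd⟩⟩
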